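/- Let $a,b,c$ be nonzero real numbers and let $(P_n)_{n\ge 0}$ be the real polynomials with $P_0=1$, $P_{-n}=0$ for $n\ge 1$, and $$P_n(z)+az\,P_{n-1}(z)+b\,P_{n-2}(z)+cz\,P_{n-3}(z)=0\qquad(n\ge 1).$$ Put $\alpha=\dfrac{c}{ab}$. Then all complex zeros of $P_n$ are real for every $n\ge 0$ if and only if $b>0$ and $\alpha\le \frac19$. In that case put $$\lambda=\frac{4}{\left(\frac{3\alpha+1+\sqrt{9\alpha^2-10\alpha+1}}{-5\alpha+1+\sqrt{9\alpha^2-10\alpha+1}}\right)^{3/2}\left(-5\alpha+1+\sqrt{9\alpha^2-10\alpha+1}\right)},\qquad \Lambda=\frac{\sqrt b}{|a|}\,\lambda .$$ Then all zeros of every $P_n$ lie in the open interval $(-\Lambda,\Lambda)$, and for every $N\ge 0$ the set of the zeros of all $P_n$ with $n\ge N$ is dense in $(-\Lambda,\Lambda)$; in particular (with $N=0$) the union of all the zero sets is dense in it. (For $a=b=1$, $c=\alpha$ one has $\Lambda=\lambda$.) -/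

import Mathlib

/-- The polynomials `P_n` with `P_n + a z P_{n-1} + b P_{n-2} + c z P_{n-3} = 0` for `n ≥ 1`,
`P_0 = 1` and `P_{-1} = P_{-2} = 0`; the lines for `n = 1, 2` are the recurrence with the terms of
negative index left out. -/
noncomputable def fourTermPoly (a b c : ℝ) : ℕ → Polynomial ℝ
  | 0 => 1
  | 1 => -(Polynomial.C a * Polynomial.X)
  | 2 => -(Polynomial.C a * Polynomial.X * fourTermPoly a b c 1)
      - Polynomial.C b * fourTermPoly a b c 0
  | n + 3 => -(Polynomial.C a * Polynomial.X * fourTermPoly a b c (n + 2))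
      - Polynomial.C b * fourTermPoly a b c (n + 1)
      - Polynomial.C c * Polynomial.X * fourTermPoly a b c n

/-- The set of complex zeros of a real polynomial. -/
def complexZeros (p : Polynomial ℝ) : Set ℂ := {z | Polynomial.aeval z p = 0}

/-- A real polynomial is hyperbolic if all its complex zeros are real. -/
def IsHyperbolic (p : Polynomial ℝ) : Prop := ∀ z ∈ complexZeros p, z.im = 0

/-- The number `λ`, as a function of `α`. -/
noncomputable def zeroBound (α : ℝ) : ℝ :=
  4 / (((3 * α + 1 + Real.sqrt (9 * α ^ 2 - 10 * α + 1)) /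
        (-5 * α + 1 + Real.sqrt (9 * α ^ 2 - 10 * α + 1))) ^ ((3 : ℝ) / 2) *
      (-5 * α + 1 + Real.sqrt (9 * α ^ 2 - 10 * α + 1)))

/-- The half-length `(√b / |a|) λ(α)`, `α = c / (a b)`, of the interval of zeros in the variable
`z`: the change of variables `z' = (a / √b) z` reduces the recurrence to `a = b = 1`, where the
half-length is `λ(α)`. -/
noncomputable def zeroRadius (a b c : ℝ) : ℝ :=
  Real.sqrt b / |a| * zeroBound (c / (a * b))

/-!
A change of variables reduces the recurrence to `a = b = 1`, `c = α`. The value `P_n(z)` is then the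
complete homogeneous symmetric polynomial of degree `n` in the roots of the cubic
`x³ + z x² + x + α z`.

For `α ≤ 1/9` the zeros are found explicitly. For every `u = 2 cos θ` with `0 < θ < π` there is a real
`z = zeroParam α u` at which the roots of the cubic are `ρ e^{iθ}`, `ρ e^{-iθ}`, `ρ s` with `ρ > 0` and
`|s| < 1`, and there `P_n(z)` is a positive multiple of
`sin((n+1)θ) - s sin((n+2)θ) + s^{n+2} sin θ` (`sin_mul_aeval_fourTermPoly`). At the `n + 1` angles
`(2j+1)π / (2(n+1))` this has the sign `(-1)^j`, because `s² sin θ < 1 - s cos θ`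
(`sq_thirdRoot_mul_sin_lt`), so there are `n` angles between them where `P_n` vanishes. The cubic
determines its pair of nonreal roots, so `zeroParam α` is injective on `[-2, 2]`; hence these `n`
zeros are distinct and are all the zeros of `P_n`. Being continuous, `zeroParam α` maps `(-2, 2)`
decreasingly onto the interval between its values `±zeroBound α` at the end points, and the angles
become dense as `n` grows.

Conversely, `P_2` forces `b > 0` and `P_4` forces `α ≤ 1/2`. Suppose that `1/9 < α ≤ 1/2` and that
all zeros of all `P_n` are real; they lie in `[-4, 4]`. The functions `P_n' / (n P_n)` are averages of
the kernels `1 / (z - r)` with `r` in that interval, so by weak-* compactness they have a limit `G`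
holomorphic off it (`exists_differentiableOn_limit`). Write `z(x) = -(x³ + x) / (x² + α)` for the
parameter at which `x` is a root of the cubic. For large `x` this root dominates and `P_n(z(x)) / xⁿ`
stays close to `1`, whence `G(z(x)) z'(x) = 1 / x`. By the identity theorem this persists along any
path on which `z(x)` is not real. The radial path from infinity to a critical point of `z(x)` is such
a path (`exists_critical_ray`), and at its end the left side is `0`, which is impossible.
-/

open Polynomial Filter Topology

/-! ### The recurrence -/

section Recurrence

variable {A : Type*} [CommRing A] [Algebra ℝ A] (a b c : ℝ) (x : A)

lemma aeval_fourTermPoly_zero : aeval x (fourTermPoly a b c 0) = 1 := by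
  simp [fourTermPoly]

lemma aeval_fourTermPoly_one :
    aeval x (fourTermPoly a b c 1) = -(algebraMap ℝ A a * x) := by
  simp [fourTermPoly]

lemma aeval_fourTermPoly_two :
    aeval x (fourTermPoly a b c 2) =
      -(algebraMap ℝ A a * x * aeval x (fourTermPoly a b c 1)) - algebraMap ℝ A b := by
  simp [fourTermPoly]

lemma aeval_fourTermPoly_add_three (n : ℕ) :
    aeval x (fourTermPoly a b c (n + 3)) =
      -(algebraMap ℝ A a * x * aeval x (fourTermPoly a b c (n + 2)))
        - algebraMap ℝ A b * aeval x (fourTermPoly a b c (n + 1))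
        - algebraMap ℝ A c * x * aeval x (fourTermPoly a b c n) := by
  rw [fourTermPoly]
  simp

/-- The values of the polynomials are determined by the recurrence. -/
lemma aeval_fourTermPoly_eq_of_recurrence {f : ℕ → A} (h0 : f 0 = 1)
    (h1 : f 1 = -(algebraMap ℝ A a * x))
    (h2 : f 2 = -(algebraMap ℝ A a * x * f 1) - algebraMap ℝ A b)
    (h3 : ∀ n, f (n + 3) = -(algebraMap ℝ A a * x * f (n + 2))
      - algebraMap ℝ A b * f (n + 1) - algebraMap ℝ A c * x * f n) (n : ℕ) :
    aeval x (fourTermPoly a b c n) = f n := by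
  induction n using Nat.strong_induction_on with
  | _ n ih =>
    match n, ih with
    | 0, _ => rw [h0, aeval_fourTermPoly_zero]
    | 1, _ => rw [h1, aeval_fourTermPoly_one]
    | 2, ih => rw [h2, aeval_fourTermPoly_two, ih 1 (by omega)]
    | n + 3, ih =>
      rw [h3, aeval_fourTermPoly_add_three, ih n (by omega), ih (n + 1) (by omega),
        ih (n + 2) (by omega)]

end Recurrence

lemma natDegree_le_and_coeff_fourTermPoly (α : ℝ) (n : ℕ) :
    (fourTermPoly 1 1 α n).natDegree ≤ n ∧ (fourTermPoly 1 1 α n).coeff n = (-1) ^ n := by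
  induction n using Nat.strong_induction_on with
  | _ n ih =>
    match n, ih with
    | 0, _ => simp [fourTermPoly]
    | 1, _ =>
      simp only [fourTermPoly, map_one, one_mul]
      refine ⟨?_, by simp⟩
      rw [natDegree_neg]
      exact natDegree_X_le
    | 2, ih =>
      obtain ⟨h1, h1'⟩ := ih 1 (by omega)
      rw [fourTermPoly]
      simp only [map_one, one_mul, fourTermPoly] at h1 h1' ⊢
      constructor
      · compute_degree
      · simp [coeff_one]
    | n + 3, ih =>
      obtain ⟨h2, h2'⟩ := ih (n + 2) (by omega)
      obtain ⟨h1, -⟩ := ih (n + 1) (by omega)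
      obtain ⟨h0, -⟩ := ih n (by omega)
      rw [fourTermPoly]
      simp only [map_one, one_mul]
      have e1 : (X * fourTermPoly 1 1 α (n + 2)).natDegree ≤ n + 3 :=
        natDegree_mul_le.trans (by have := natDegree_X_le (R := ℝ); omega)
      have e2 : (C α * X * fourTermPoly 1 1 α n).natDegree ≤ n + 1 :=
        natDegree_mul_le.trans (by
          have := natDegree_C_mul_le α (X : ℝ[X])
          have := natDegree_X_le (R := ℝ)
          omega)
      constructor
      · refine (natDegree_sub_le_of_le (natDegree_sub_le_of_le ?_ ?_) ?_ :
          _ ≤ max (max (n + 3) (n + 3)) (n + 3)).trans (by simp)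
        · rw [natDegree_neg]; exact e1
        · omega
        · omega
      · rw [coeff_sub, coeff_sub, coeff_neg, coeff_X_mul, h2',
          coeff_eq_zero_of_natDegree_lt (by omega : _ < n + 3),
          coeff_eq_zero_of_natDegree_lt (by omega : _ < n + 3)]
        ring

lemma natDegree_fourTermPoly_one (α : ℝ) (n : ℕ) : (fourTermPoly 1 1 α n).natDegree = n := by
  obtain ⟨h, h'⟩ := natDegree_le_and_coeff_fourTermPoly α n
  refine le_antisymm h (le_natDegree_of_ne_zero ?_)
  rw [h']
  exact pow_ne_zero _ (by norm_num)

lemma fourTermPoly_one_ne_zero (α : ℝ) (n : ℕ) : fourTermPoly 1 1 α n ≠ 0 := by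
  intro h
  have := (natDegree_le_and_coeff_fourTermPoly α n).2
  rw [h, coeff_zero] at this
  exact pow_ne_zero n (by norm_num : (-1 : ℝ) ≠ 0) this.symm

/-- The change of variables `z ↦ (a / √b) z` reduces the recurrence to `a = b = 1`. -/
lemma aeval_fourTermPoly_scale {a b : ℝ} (c : ℝ) (ha : a ≠ 0) (hb : 0 < b) (z : ℂ) (n : ℕ) :
    aeval z (fourTermPoly a b c n) =
      (√b : ℂ) ^ n * aeval ((a / √b : ℝ) * z) (fourTermPoly 1 1 (c / (a * b)) n) := by
  have hs : (√b : ℂ) ≠ 0 := by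
    simpa using (Real.sqrt_pos.2 hb).ne'
  have hs2 : (b : ℂ) = (√b : ℂ) ^ 2 := by
    rw [← Complex.ofReal_pow, Real.sq_sqrt hb.le]
  have ha' : (a : ℂ) ≠ 0 := by simpa using ha
  refine aeval_fourTermPoly_eq_of_recurrence a b c z (f := fun n => (√b : ℂ) ^ n *
    aeval ((a / √b : ℝ) * z) (fourTermPoly 1 1 (c / (a * b)) n)) ?_ ?_ ?_ (fun n => ?_) n
  · simp [aeval_fourTermPoly_zero]
  · simp only [aeval_fourTermPoly_one, Complex.coe_algebraMap, map_one]
    push_cast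
    field_simp
  · simp only [aeval_fourTermPoly_two, aeval_fourTermPoly_one, Complex.coe_algebraMap, map_one]
    push_cast
    rw [hs2]
    field_simp
  · simp only [aeval_fourTermPoly_add_three, Complex.coe_algebraMap, map_one]
    push_cast
    rw [hs2]
    field_simp
    ring

lemma mem_complexZeros {p : ℝ[X]} {z : ℂ} : z ∈ complexZeros p ↔ aeval z p = 0 := Iff.rfl

lemma mem_complexZeros_scale {a b : ℝ} (c : ℝ) (ha : a ≠ 0) (hb : 0 < b) (z : ℂ) (n : ℕ) :
    z ∈ complexZeros (fourTermPoly a b c n) ↔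
      ((a / √b : ℝ) * z : ℂ) ∈ complexZeros (fourTermPoly 1 1 (c / (a * b)) n) := by
  have hs : (√b : ℂ) ≠ 0 := by
    simpa using (Real.sqrt_pos.2 hb).ne'
  simp only [mem_complexZeros, aeval_fourTermPoly_scale c ha hb z n,
    mul_eq_zero, pow_ne_zero n hs, false_or]

/-! ### The parametrization of the zeros -/

/-- The discriminant `(1 - α(1 + u²))² - 4α²u²` of the quadratic equation
`α u s² - (1 - α(1 + u²)) s + α u = 0`. -/
noncomputable def thirdRootDisc (α u : ℝ) : ℝ :=
  (1 - α * (1 + u ^ 2)) ^ 2 - 4 * α ^ 2 * u ^ 2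

/-- The denominator `1 - α(1 + u²) + √disc` in `thirdRoot`. -/
noncomputable def thirdRootDenom (α u : ℝ) : ℝ :=
  1 - α * (1 + u ^ 2) + √(thirdRootDisc α u)

/-- The solution `s` with `|s| ≤ 1` of `α u s² - (1 - α(1 + u²)) s + α u = 0`, in the form that has
no singularity at `u = 0`. The numbers `e^{iθ}`, `e^{-iθ}`, `s`, where `u = 2 cos θ`, are the roots
of `x³ + z x² + x + α z` for `z = zeroParam α u`, up to a common positive factor. -/
noncomputable def thirdRoot (α u : ℝ) : ℝ := 2 * α * u / thirdRootDenom α u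

/-- The point `z` at which the roots of `x³ + z x² + x + α z` are proportional to `e^{iθ}`,
`e^{-iθ}`, `s`, where `u = 2 cos θ` and `s = thirdRoot α u`. -/
noncomputable def zeroParam (α u : ℝ) : ℝ :=
  -(u + thirdRoot α u) / √(1 + u * thirdRoot α u)

section

variable {α u : ℝ}

lemma two_mul_abs_le (hα : α ≤ 1 / 9) (hu : u ∈ Set.Icc (-2 : ℝ) 2) :
    |2 * α * u| ≤ 1 - α * (1 + u ^ 2) := by
  obtain ⟨h1, h2⟩ := hu
  rw [abs_le]
  rcases le_total 0 α with h | h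
  · constructor <;> nlinarith
  · constructor <;> nlinarith [sq_nonneg (u + 1), sq_nonneg (u - 1)]

lemma two_mul_abs_lt (hα : α ≤ 1 / 9) (hu : u ∈ Set.Ioo (-2 : ℝ) 2) :
    |2 * α * u| < 1 - α * (1 + u ^ 2) := by
  obtain ⟨h1, h2⟩ := hu
  rw [abs_lt]
  rcases le_or_gt α 0 with h | h
  · constructor <;> nlinarith [sq_nonneg (u + 1), sq_nonneg (u - 1)]
  · have h3 : 0 < (2 - u) * (4 + u) := mul_pos (by linarith) (by linarith)
    have h4 : 0 < (2 + u) * (4 - u) := mul_pos (by linarith) (by linarith)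
    constructor <;> nlinarith

lemma linear_coeff_pos (hα : α ≤ 1 / 9) (hu : u ∈ Set.Icc (-2 : ℝ) 2) :
    0 < 1 - α * (1 + u ^ 2) := by
  obtain ⟨h1, h2⟩ := hu
  rcases le_total 0 α with h | h <;> nlinarith

lemma thirdRootDisc_nonneg (hα : α ≤ 1 / 9) (hu : u ∈ Set.Icc (-2 : ℝ) 2) :
    0 ≤ thirdRootDisc α u := by
  have h := sq_le_sq' (by linarith [abs_nonneg (2 * α * u), two_mul_abs_le hα hu])
    (two_mul_abs_le hα hu)
  rw [sq_abs] at h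
  rw [thirdRootDisc]
  linarith

lemma thirdRootDenom_pos (hα : α ≤ 1 / 9) (hu : u ∈ Set.Icc (-2 : ℝ) 2) :
    0 < thirdRootDenom α u :=
  add_pos_of_pos_of_nonneg (linear_coeff_pos hα hu) (Real.sqrt_nonneg _)

lemma thirdRoot_eq (hα : α ≤ 1 / 9) (hu : u ∈ Set.Icc (-2 : ℝ) 2) :
    α * u * thirdRoot α u ^ 2 - (1 - α * (1 + u ^ 2)) * thirdRoot α u + α * u = 0 := by
  have hw := (thirdRootDenom_pos hα hu).ne'
  have hR := Real.sq_sqrt (thirdRootDisc_nonneg hα hu)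
  have hD : √(thirdRootDisc α u) = thirdRootDenom α u - (1 - α * (1 + u ^ 2)) := by
    rw [thirdRootDenom]; ring
  rw [hD, thirdRootDisc] at hR
  rw [thirdRoot]
  field_simp
  linear_combination α * u * hR

lemma abs_thirdRoot_lt_one (hα : α ≤ 1 / 9) (hu : u ∈ Set.Ioo (-2 : ℝ) 2) :
    |thirdRoot α u| < 1 := by
  have hw := thirdRootDenom_pos hα (Set.Ioo_subset_Icc_self hu)
  rw [thirdRoot, abs_div, abs_of_pos hw, div_lt_one hw]
  exact (two_mul_abs_lt hα hu).trans_le (le_add_of_nonneg_right (Real.sqrt_nonneg _))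

lemma abs_thirdRoot_le_one (hα : α ≤ 1 / 9) (hu : u ∈ Set.Icc (-2 : ℝ) 2) :
    |thirdRoot α u| ≤ 1 := by
  have hw := thirdRootDenom_pos hα hu
  rw [thirdRoot, abs_div, abs_of_pos hw, div_le_one hw]
  exact (two_mul_abs_le hα hu).trans (le_add_of_nonneg_right (Real.sqrt_nonneg _))

/-- This makes the scaling factor `ρ`, which satisfies `ρ² (1 + u s) = 1`, a real number. -/
lemma one_add_mul_thirdRoot_pos (hα : α ≤ 1 / 9) (hu : u ∈ Set.Icc (-2 : ℝ) 2) :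
    0 < 1 + u * thirdRoot α u := by
  have hw := thirdRootDenom_pos hα hu
  have e : 1 + u * thirdRoot α u = (thirdRootDenom α u + 2 * α * u ^ 2) / thirdRootDenom α u := by
    rw [thirdRoot]; field_simp
  rw [e]
  refine div_pos ?_ hw
  rcases le_or_gt 0 α with h | h
  · positivity
  · have h1 : -α * (u ^ 2 - 1) ≤ √(thirdRootDisc α u) := by
      refine Real.le_sqrt_of_sq_le ?_
      rw [thirdRootDisc]
      nlinarith [mul_nonneg (neg_nonneg.2 h.le) (sq_nonneg u)]
    rw [thirdRootDenom]
    linarith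

lemma thirdRoot_mul_nonneg (hα : α ≤ 1 / 9) (hu : u ∈ Set.Icc (-2 : ℝ) 2) :
    0 ≤ α * (thirdRoot α u * u) := by
  have hw := thirdRootDenom_pos hα hu
  have e : α * (thirdRoot α u * u) = 2 * (α * u) ^ 2 / thirdRootDenom α u := by
    rw [thirdRoot]; ring
  rw [e]
  positivity

lemma thirdRoot_neg : thirdRoot α (-u) = -thirdRoot α u := by
  simp [thirdRoot, thirdRootDenom, thirdRootDisc, neg_div]

lemma zeroParam_neg : zeroParam α (-u) = -zeroParam α u := by
  rw [zeroParam, zeroParam, thirdRoot_neg, neg_mul_neg]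
  ring

lemma continuousOn_thirdRoot (hα : α ≤ 1 / 9) :
    ContinuousOn (thirdRoot α) (Set.Icc (-2) 2) := by
  refine ContinuousOn.div (by fun_prop) ?_ fun u hu => (thirdRootDenom_pos hα hu).ne'
  unfold thirdRootDenom thirdRootDisc
  fun_prop

lemma continuousOn_zeroParam (hα : α ≤ 1 / 9) :
    ContinuousOn (zeroParam α) (Set.Icc (-2) 2) := by
  have h := continuousOn_thirdRoot hα
  exact ContinuousOn.div (by fun_prop) (by fun_prop)
    fun u hu => (Real.sqrt_pos.2 (one_add_mul_thirdRoot_pos hα hu)).ne'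

/-- The elementary symmetric functions of `ρ e^{iθ}`, `ρ e^{-iθ}`, `ρ s` are those of the roots of
`x³ + z x² + x + α z`. -/
lemma exists_scale (hα : α ≤ 1 / 9) (hu : u ∈ Set.Icc (-2 : ℝ) 2) :
    ∃ ρ : ℝ, 0 < ρ ∧ zeroParam α u = -(ρ * (u + thirdRoot α u)) ∧
      ρ ^ 2 * (1 + u * thirdRoot α u) = 1 ∧
      ρ ^ 3 * thirdRoot α u = -(α * zeroParam α u) := by
  have hp := one_add_mul_thirdRoot_pos hα hu
  have hs := Real.sqrt_pos.2 hp
  have hsq := Real.sq_sqrt hp.le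
  have h1 : zeroParam α u = -((√(1 + u * thirdRoot α u))⁻¹ * (u + thirdRoot α u)) := by
    rw [zeroParam]; field_simp
  have h2 : (√(1 + u * thirdRoot α u))⁻¹ ^ 2 * (1 + u * thirdRoot α u) = 1 := by
    rw [inv_pow, hsq]; exact inv_mul_cancel₀ hp.ne'
  refine ⟨(√(1 + u * thirdRoot α u))⁻¹, inv_pos.2 hs, h1, h2, ?_⟩
  rw [h1]
  generalize (√(1 + u * thirdRoot α u))⁻¹ = ρ at *
  have h := thirdRoot_eq hα hu
  linear_combination -ρ ^ 3 * h + α * ρ * (u + thirdRoot α u) * h2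

/-- Equal values of `zeroParam` give the same cubic; a real cubic with a pair of nonreal roots has only
one real root and one such pair, which determines `u`. -/
lemma zeroParam_eq_imp (hα : α ≤ 1 / 9) (hu : u ∈ Set.Icc (-2 : ℝ) 2) {v : ℝ}
    (hv : v ∈ Set.Ioo (-2 : ℝ) 2) (h : zeroParam α u = zeroParam α v) : u = v := by
  obtain ⟨ρ, hρ, h1, h2, h3⟩ := exists_scale hα hu
  obtain ⟨ρ', hρ', h1', h2', h3'⟩ := exists_scale hα (Set.Ioo_subset_Icc_self hv)
  generalize thirdRoot α u = s at *
  generalize thirdRoot α v = s' at *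
  have e1 : ρ * (u + s) = ρ' * (v + s') := by linarith
  have e3 : ρ ^ 3 * s = ρ' ^ 3 * s' := by rw [h3, h3', h]
  -- the cubic with roots from `v` vanishes at the real root `ρ s` from `u`
  have hprod : ((ρ * s) ^ 2 - ρ' * v * (ρ * s) + ρ' ^ 2) * (ρ * s - ρ' * s') = 0 := by
    linear_combination ((ρ * s) ^ 2) * e1 - ρ * s * (h2 - h2') + e3
  have hpos : 0 < (ρ * s) ^ 2 - ρ' * v * (ρ * s) + ρ' ^ 2 := by
    have : 0 < (2 - v) * (2 + v) := mul_pos (by linarith [hv.2]) (by linarith [hv.1])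
    have : 0 < ρ' ^ 2 * ((2 - v) * (2 + v)) := by positivity
    nlinarith [sq_nonneg (2 * (ρ * s) - ρ' * v)]
  have hs : ρ * s = ρ' * s' := by
    rcases mul_eq_zero.1 hprod with h | h
    · exact absurd h hpos.ne'
    · linarith
  have hu' : ρ * u = ρ' * v := by linarith
  have hsq : ρ ^ 2 = ρ' ^ 2 := by linear_combination h2 - h2' - ρ * u * hs - ρ' * s' * hu'
  have hρρ : ρ = ρ' := by
    rwa [pow_left_inj₀ hρ.le hρ'.le two_ne_zero] at hsq
  rw [hρρ] at hu'
  exact mul_left_cancel₀ hρ'.ne' hu'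

lemma zeroParam_two_neg (hα : α ≤ 1 / 9) : zeroParam α 2 < 0 := by
  have h2 : (2 : ℝ) ∈ Set.Icc (-2 : ℝ) 2 := by norm_num
  have := (abs_le.1 (abs_thirdRoot_le_one hα h2)).1
  rw [zeroParam, neg_div, neg_lt_zero]
  exact div_pos (by linarith) (Real.sqrt_pos.2 (one_add_mul_thirdRoot_pos hα h2))

lemma injOn_zeroParam (hα : α ≤ 1 / 9) : Set.InjOn (zeroParam α) (Set.Icc (-2) 2) := by
  intro u hu v hv h
  by_cases hv' : v ∈ Set.Ioo (-2 : ℝ) 2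
  · exact zeroParam_eq_imp hα hu hv' h
  by_cases hu' : u ∈ Set.Ioo (-2 : ℝ) 2
  · exact (zeroParam_eq_imp hα hv hu' h.symm).symm
  have ends : ∀ w ∈ Set.Icc (-2 : ℝ) 2, w ∉ Set.Ioo (-2 : ℝ) 2 → w = -2 ∨ w = 2 := by
    rintro w ⟨h1, h2⟩ h3
    by_contra! h4
    exact h3 ⟨lt_of_le_of_ne h1 h4.1.symm, lt_of_le_of_ne h2 h4.2⟩
  have h0 := zeroParam_two_neg hα
  rcases ends u hu hu' with rfl | rfl <;> rcases ends v hv hv' with rfl | rfl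
  · rfl
  · rw [zeroParam_neg] at h; linarith
  · rw [zeroParam_neg] at h; linarith
  · rfl

lemma strictAntiOn_zeroParam (hα : α ≤ 1 / 9) :
    StrictAntiOn (zeroParam α) (Set.Icc (-2) 2) := by
  refine (continuousOn_zeroParam hα).strictAntiOn_of_injOn_Icc (by norm_num) ?_
    (injOn_zeroParam hα)
  have h0 := zeroParam_two_neg hα
  rw [zeroParam_neg]
  linarith

lemma zeroParam_two (hα : α ≤ 1 / 9) : zeroParam α 2 = -zeroBound α := by
  have h2 : (2 : ℝ) ∈ Set.Icc (-2 : ℝ) 2 := by norm_num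
  have hp := one_add_mul_thirdRoot_pos hα h2
  have hw := thirdRootDenom_pos hα h2
  have hw' : -5 * α + 1 + √(9 * α ^ 2 - 10 * α + 1) = thirdRootDenom α 2 := by
    rw [thirdRootDenom, thirdRootDisc]; ring_nf
  have hr : (3 * α + 1 + √(9 * α ^ 2 - 10 * α + 1)) / thirdRootDenom α 2 =
      1 + 2 * thirdRoot α 2 := by
    rw [show 3 * α + 1 + √(9 * α ^ 2 - 10 * α + 1) = thirdRootDenom α 2 + 8 * α by linarith,
      thirdRoot]
    field_simp
    ring
  have hpow : (1 + 2 * thirdRoot α 2) ^ ((3 : ℝ) / 2) =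
      (1 + 2 * thirdRoot α 2) * √(1 + 2 * thirdRoot α 2) := by
    rw [show (3 : ℝ) / 2 = 1 + 1 / 2 by norm_num, Real.rpow_add hp, Real.rpow_one,
      Real.sqrt_eq_rpow]
  rw [zeroBound, hw', hr, hpow, zeroParam]
  have hs := Real.sqrt_pos.2 hp
  have key : (2 + thirdRoot α 2) * ((1 + 2 * thirdRoot α 2) * thirdRootDenom α 2) = 4 := by
    have hD : √(thirdRootDisc α 2) = thirdRootDenom α 2 - (1 - 5 * α) := by
      rw [thirdRootDenom]; ring
    have hR := Real.sq_sqrt (thirdRootDisc_nonneg hα h2)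
    rw [hD, thirdRootDisc] at hR
    rw [thirdRoot]
    field_simp
    linear_combination 2 * hR
  rw [neg_div, neg_inj, div_eq_div_iff hs.ne' (by positivity)]
  linear_combination √(1 + 2 * thirdRoot α 2) * key

lemma zeroParam_mem_Ioo (hα : α ≤ 1 / 9) (hu : u ∈ Set.Ioo (-2 : ℝ) 2) :
    zeroParam α u ∈ Set.Ioo (-zeroBound α) (zeroBound α) := by
  have h := strictAntiOn_zeroParam hα
  have h2 : (2 : ℝ) ∈ Set.Icc (-2 : ℝ) 2 := by norm_num
  have h2' : (-2 : ℝ) ∈ Set.Icc (-2 : ℝ) 2 := by norm_num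
  have hu' := Set.Ioo_subset_Icc_self hu
  constructor
  · rw [← zeroParam_two hα]; exact h hu' h2 hu.2
  · have := h h2' hu' hu.1
    rwa [zeroParam_neg, zeroParam_two hα, neg_neg] at this

lemma exists_zeroParam_eq (hα : α ≤ 1 / 9) {x : ℝ}
    (hx : x ∈ Set.Ioo (-zeroBound α) (zeroBound α)) :
    ∃ u ∈ Set.Ioo (-2 : ℝ) 2, zeroParam α u = x := by
  have := intermediate_value_Ioo' (by norm_num : (-2 : ℝ) ≤ 2) (continuousOn_zeroParam hα)
  rw [zeroParam_neg, zeroParam_two hα, neg_neg] at this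
  exact this hx

end

/-! ### The zeros for `b > 0` and `α ≤ 1/9` -/

lemma aeval_ofReal_eq (p : ℝ[X]) (x : ℝ) : aeval (x : ℂ) p = ((aeval x p : ℝ) : ℂ) :=
  aeval_algebraMap_apply ℂ x p

lemma sin_nat_mul_add_two (θ : ℝ) (m : ℕ) :
    Real.sin ((m + 2 : ℕ) * θ) =
      2 * Real.cos θ * Real.sin ((m + 1 : ℕ) * θ) - Real.sin (m * θ) := by
  have h1 : ((m + 2 : ℕ) : ℝ) * θ = (m + 1 : ℕ) * θ + θ := by push_cast; ring
  have h2 : (m : ℝ) * θ = (m + 1 : ℕ) * θ - θ := by push_cast; ring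
  rw [h1, h2, Real.sin_add, Real.sin_sub]
  ring

/-- The complete homogeneous symmetric polynomial of degree `n` in `ρ e^{iθ}`, `ρ e^{-iθ}`, `ρ s`,
which is the value of the `n`-th polynomial, in closed form. -/
lemma sin_mul_aeval_fourTermPoly {α ρ s z θ : ℝ} (hz : z = -(ρ * (2 * Real.cos θ + s)))
    (hρ : ρ ^ 2 * (1 + 2 * Real.cos θ * s) = 1) (hs : ρ ^ 3 * s = -(α * z)) (n : ℕ) :
    Real.sin θ * (1 - 2 * Real.cos θ * s + s ^ 2) * aeval z (fourTermPoly 1 1 α n) =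
      ρ ^ n * (Real.sin ((n + 1 : ℕ) * θ) - s * Real.sin ((n + 2 : ℕ) * θ)
        + s ^ (n + 2) * Real.sin θ) := by
  have hσ := sin_nat_mul_add_two θ
  have h0 : Real.sin ((0 : ℕ) * θ) = 0 := by simp
  have h1 : Real.sin ((1 : ℕ) * θ) = Real.sin θ := by simp
  generalize 2 * Real.cos θ = u at *
  generalize Real.sin θ = w at *
  generalize hσ' : (fun m : ℕ => Real.sin (m * θ)) = σ
  have e : ∀ m : ℕ, Real.sin (m * θ) = σ m := fun m => by rw [← hσ']
  simp only [e] at *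
  have h2 : σ 2 = u * w := by rw [hσ 0, h0, h1]; ring
  have h3 : σ 3 = u * (u * w) - w := by rw [hσ 1, h2, h1]
  have h4 : σ 4 = u * (u * (u * w) - w) - u * w := by rw [hσ 2, h3, h2]
  induction n using Nat.strong_induction_on with
  | _ n ih =>
    match n, ih with
    | 0, _ => simp only [aeval_fourTermPoly_zero, zero_add, h1, h2]; ring
    | 1, _ =>
      simp only [aeval_fourTermPoly_one, Nat.reduceAdd, h2, h3, map_one, hz]
      ring
    | 2, _ =>
      simp only [aeval_fourTermPoly_one, aeval_fourTermPoly_two, Nat.reduceAdd, h3, h4, map_one, hz]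
      linear_combination w * (1 - u * s + s ^ 2) * hρ
    | n + 3, ih =>
      have i0 := ih n (by omega)
      have i1 := ih (n + 1) (by omega)
      have i2 := ih (n + 2) (by omega)
      have r5 := hσ (n + 3)
      have r4 := hσ (n + 2)
      have r3 := hσ (n + 1)
      simp only [add_assoc, Nat.reduceAdd] at i0 i1 i2 r3 r4 r5 ⊢
      rw [aeval_fourTermPoly_add_three]
      simp only [map_one, Algebra.algebraMap_self, RingHom.id_apply]
      generalize aeval z (fourTermPoly 1 1 α n) = p0 at *
      generalize aeval z (fourTermPoly 1 1 α (n + 1)) = p1 at *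
      generalize aeval z (fourTermPoly 1 1 α (n + 2)) = p2 at *
      have hz' : -(z) = ρ * (u + s) := by rw [hz]; ring
      have key : w * (1 - u * s + s ^ 2) * (-(1 * z * p2) - 1 * p1 - α * z * p0) =
          ρ * (u + s) * (w * (1 - u * s + s ^ 2) * p2)
          - ρ ^ 2 * (1 + u * s) * (w * (1 - u * s + s ^ 2) * p1)
          + ρ ^ 3 * s * (w * (1 - u * s + s ^ 2) * p0) := by
        linear_combination w * (1 - u * s + s ^ 2) * (p2 * hz' + p1 * hρ - p0 * hs)
      rw [key, i0, i1, i2, r5, r4, r3]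
      ring

lemma two_mul_cos_mem_Ioo {θ : ℝ} (hθ : θ ∈ Set.Ioo 0 Real.pi) :
    2 * Real.cos θ ∈ Set.Ioo (-2 : ℝ) 2 := by
  have h1 := Real.strictAntiOn_cos ⟨le_rfl, Real.pi_pos.le⟩ ⟨hθ.1.le, hθ.2.le⟩ hθ.1
  have h2 := Real.strictAntiOn_cos ⟨hθ.1.le, hθ.2.le⟩ ⟨Real.pi_pos.le, le_rfl⟩ hθ.2
  rw [Real.cos_zero] at h1
  rw [Real.cos_pi] at h2
  constructor <;> linarith

/-- The bound which makes the first two terms of the closed form dominate the last one. -/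
lemma sq_thirdRoot_mul_sin_lt {α θ : ℝ} (hα : α ≤ 1 / 9) (hθ : θ ∈ Set.Ioo 0 Real.pi) :
    thirdRoot α (2 * Real.cos θ) ^ 2 * Real.sin θ <
      1 - thirdRoot α (2 * Real.cos θ) * Real.cos θ := by
  have hu := two_mul_cos_mem_Ioo hθ
  have heq := thirdRoot_eq hα (Set.Ioo_subset_Icc_self hu)
  have hs1 := abs_thirdRoot_lt_one hα hu
  have hsg := thirdRoot_mul_nonneg hα (Set.Ioo_subset_Icc_self hu)
  have hsin := Real.sin_pos_of_mem_Ioo hθ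
  have hsin1 := Real.sin_le_one θ
  have hsc := Real.sin_sq_add_cos_sq θ
  generalize thirdRoot α (2 * Real.cos θ) = s at *
  generalize Real.cos θ = k at *
  generalize Real.sin θ = w at *
  have hs2 : s ^ 2 < 1 := by rwa [sq_lt_one_iff_abs_lt_one]
  rcases le_or_gt (s * k) 0 with h | h
  · nlinarith
  have hα0 : 0 ≤ α := by
    by_contra! h'
    nlinarith
  -- replace `s` and `k`, which have the same sign, by their absolute values
  have hsk : s * k = |s| * |k| := by rw [← abs_mul, abs_of_pos h]
  have heq' : |s| * (1 - α * (1 + 4 * |k| ^ 2)) = 2 * α * |k| * (1 + |s| ^ 2) := by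
    rw [sq_abs, sq_abs]
    have hk0 : k ≠ 0 := by rintro rfl; simp at h
    rcases lt_or_gt_of_ne hk0 with hk | hk
    · rw [abs_of_neg hk, abs_of_neg (by nlinarith : s < 0)]; linear_combination heq
    · rw [abs_of_pos hk, abs_of_pos (by nlinarith : 0 < s)]; linear_combination -heq
  have hk2 : |k| ^ 2 = 1 - w ^ 2 := by rw [sq_abs]; linarith
  rw [hsk, ← sq_abs s]
  have hkpos : 0 < |k| := by
    rw [abs_pos]; rintro rfl; simp at h
  have hspos : 0 < |s| := by
    rw [abs_pos]; rintro rfl; simp at h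
  generalize |s| = σ at *
  generalize |k| = κ at *
  have hκ1 : κ < 1 := by nlinarith
  have hα' : 0 < α := by
    rcases hα0.eq_or_lt with h' | h'
    · rw [← h'] at heq'; nlinarith
    · exact h'
  have h8 : σ * (8 - 4 * κ ^ 2) ≤ 2 * κ * (1 + σ ^ 2) := by
    have : α * (σ * (8 - 4 * κ ^ 2)) ≤ α * (2 * κ * (1 + σ ^ 2)) := by nlinarith
    exact le_of_mul_le_mul_left this hα'
  have h9 : κ * (2 * σ * w ^ 2) ≤ κ * (1 - σ) ^ 2 := by
    have : 0 ≤ σ * ((1 - κ) * (2 + κ - κ * (1 + κ))) := by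
      have : 0 ≤ 2 + κ - κ * (1 + κ) := by nlinarith
      have : 0 ≤ 1 - κ := by linarith
      positivity
    have hw2 : w ^ 2 = 1 - κ ^ 2 := by linarith
    have e : κ * (1 - σ) ^ 2 - κ * (2 * σ * (1 - κ ^ 2)) =
        (κ * (1 + σ ^ 2) - σ * (4 - 2 * κ ^ 2)) +
          2 * (σ * ((1 - κ) * (2 + κ - κ * (1 + κ)))) := by ring
    rw [hw2]
    linarith
  have h10 : 2 * σ * w ^ 2 ≤ (1 - σ) ^ 2 := le_of_mul_le_mul_left h9 hkpos
  have h11 : (σ ^ 2 * w) ^ 2 < (1 - σ) ^ 2 := by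
    have : σ ^ 3 ≤ 1 := pow_le_one₀ hspos.le hs1.le
    have h1 : 0 < σ * w ^ 2 := by positivity
    calc (σ ^ 2 * w) ^ 2 = σ ^ 3 * (σ * w ^ 2) := by ring
      _ ≤ 1 * (σ * w ^ 2) := by gcongr
      _ < 2 * σ * w ^ 2 := by linarith
      _ ≤ (1 - σ) ^ 2 := h10
  have h12 : σ ^ 2 * w < 1 - σ := lt_of_pow_lt_pow_left₀ 2 (by linarith) h11
  nlinarith

/-- The points at which the polynomial of degree `n` is shown to have alternating signs. -/
noncomputable def signAngle (n : ℕ) (j : ℕ) : ℝ := (2 * j + 1) * Real.pi / (2 * (n + 1))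

lemma signAngle_strictMono (n : ℕ) : StrictMono (signAngle n) := by
  intro i j h
  have h' : (i : ℝ) < j := by exact_mod_cast h
  have := Real.pi_pos
  rw [signAngle, signAngle]
  gcongr

lemma signAngle_mem_Ioo {n j : ℕ} (h : j ≤ n) : signAngle n j ∈ Set.Ioo 0 Real.pi := by
  have := Real.pi_pos
  have h' : (j : ℝ) ≤ n := by exact_mod_cast h
  rw [signAngle]
  refine ⟨by positivity, ?_⟩
  rw [div_lt_iff₀ (by positivity)]
  nlinarith

lemma signAngle_lt_of_lt {n i j : ℕ} (h : signAngle n i < signAngle n j) : i < j :=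
  (signAngle_strictMono n).lt_iff_lt.1 h

/-- The closed form at `θ = signAngle n j` reduces to `(-1)^j (1 - s cos θ) + s^{n+2} sin θ`. -/
lemma aeval_zeroParam_signAngle {α : ℝ} (hα : α ≤ 1 / 9) {n j : ℕ} (hj : j ≤ n) :
    0 < (-1) ^ j *
      aeval (zeroParam α (2 * Real.cos (signAngle n j))) (fourTermPoly 1 1 α n) := by
  have hθ := signAngle_mem_Ioo hj
  set θ := signAngle n j with hθdef
  have hu := two_mul_cos_mem_Ioo hθ
  obtain ⟨ρ, hρ, h1, h2, h3⟩ := exists_scale hα (Set.Ioo_subset_Icc_self hu)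
  have hform := sin_mul_aeval_fourTermPoly h1 h2 h3 n
  have hlt := sq_thirdRoot_mul_sin_lt hα hθ
  have hs1 := abs_thirdRoot_lt_one hα hu
  have hsin := Real.sin_pos_of_mem_Ioo hθ
  have hang : ((n + 1 : ℕ) : ℝ) * θ = j * Real.pi + Real.pi / 2 := by
    rw [hθdef, signAngle]; push_cast; field_simp
  have hS1 : Real.sin ((n + 1 : ℕ) * θ) = (-1) ^ j := by
    rw [hang, Real.sin_add_pi_div_two, Real.cos_nat_mul_pi]
  have hS2 : Real.sin ((n + 2 : ℕ) * θ) = (-1) ^ j * Real.cos θ := by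
    rw [show ((n + 2 : ℕ) : ℝ) * θ = (n + 1 : ℕ) * θ + θ by push_cast; ring, Real.sin_add, hS1,
      hang, Real.cos_add_pi_div_two, Real.sin_nat_mul_pi]
    ring
  rw [hS1, hS2] at hform
  set z := zeroParam α (2 * Real.cos θ)
  have hsc := Real.sin_sq_add_cos_sq θ
  generalize thirdRoot α (2 * Real.cos θ) = s at *
  have hT : 0 < Real.sin θ * (1 - 2 * Real.cos θ * s + s ^ 2) := by
    have : 0 < (s - Real.cos θ) ^ 2 + Real.sin θ ^ 2 := by positivity
    refine mul_pos hsin ?_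
    nlinarith
  have hpow : |s ^ (n + 2) * Real.sin θ| ≤ s ^ 2 * Real.sin θ := by
    rw [abs_mul, abs_of_pos hsin, abs_pow, ← sq_abs s]
    gcongr ?_ * _
    exact pow_le_pow_of_le_one (abs_nonneg s) hs1.le (by omega)
  have hsq : ((-1 : ℝ) ^ j) * (-1) ^ j = 1 := by
    rw [← mul_pow]; simp
  have hlast : |(-1) ^ j * (s ^ (n + 2) * Real.sin θ)| ≤ s ^ 2 * Real.sin θ := by
    rwa [abs_mul, abs_pow, abs_neg, abs_one, one_pow, one_mul]
  have hpos : 0 < ρ ^ n * (1 - s * Real.cos θ + (-1) ^ j * (s ^ (n + 2) * Real.sin θ)) := by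
    refine mul_pos (pow_pos hρ n) ?_
    linarith [(abs_le.1 hlast).1]
  refine pos_of_mul_pos_right (a := Real.sin θ * (1 - 2 * Real.cos θ * s + s ^ 2)) ?_ hT.le
  rw [mul_left_comm, hform]
  refine hpos.trans_eq ?_
  linear_combination (-ρ ^ n * (1 - s * Real.cos θ)) * hsq

/-- Between consecutive sign angles lies a zero. -/
lemma exists_zero_between {α : ℝ} (hα : α ≤ 1 / 9) {n j : ℕ} (hj : j < n) :
    ∃ θ ∈ Set.Ioo (signAngle n j) (signAngle n (j + 1)),
      aeval (zeroParam α (2 * Real.cos θ)) (fourTermPoly 1 1 α n) = 0 := by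
  have h0 := aeval_zeroParam_signAngle hα hj.le
  have h1 := aeval_zeroParam_signAngle hα (Nat.succ_le_of_lt hj)
  have hlt := signAngle_strictMono n (Nat.lt_succ_self j)
  have hI0 := signAngle_mem_Ioo hj.le
  have hI1 := signAngle_mem_Ioo (Nat.succ_le_of_lt hj)
  set f : ℝ → ℝ := fun θ =>
    (-1) ^ j * aeval (zeroParam α (2 * Real.cos θ)) (fourTermPoly 1 1 α n)
  have hcont : ContinuousOn f (Set.Icc (signAngle n j) (signAngle n (j + 1))) := by
    refine continuousOn_const.mul ((fourTermPoly 1 1 α n).continuous_aeval.comp_continuousOn ?_)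
    refine (continuousOn_zeroParam hα).comp (by fun_prop) fun θ hθ => ?_
    exact Set.Ioo_subset_Icc_self
      (two_mul_cos_mem_Ioo ⟨hI0.1.trans_le hθ.1, hθ.2.trans_lt hI1.2⟩)
  have h1' : f (signAngle n (j + 1)) < 0 := by
    have e : f (signAngle n (j + 1)) = -((-1) ^ (j + 1) *
        aeval (zeroParam α (2 * Real.cos (signAngle n (j + 1)))) (fourTermPoly 1 1 α n)) := by
      simp only [f]; ring
    rw [e]
    exact neg_neg_of_pos h1
  obtain ⟨θ, hθ, hf⟩ := intermediate_value_Ioo' hlt.le hcont ⟨h1', h0⟩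
  exact ⟨θ, hθ, (mul_eq_zero.1 hf).resolve_left (pow_ne_zero _ (by norm_num))⟩

/-- The zeros found between the sign angles are as many as the degree allows. -/
lemma complexZeros_subset_zeroParam {α : ℝ} (hα : α ≤ 1 / 9) (n : ℕ) :
    complexZeros (fourTermPoly 1 1 α n) ⊆
      Complex.ofReal '' (zeroParam α '' Set.Ioo (-2) 2) := by
  choose t ht hzero using fun j : Fin n => exists_zero_between hα j.2
  have htI : ∀ j, t j ∈ Set.Ioo 0 Real.pi := fun j =>
    ⟨(signAngle_mem_Ioo j.2.le).1.trans (ht j).1,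
      (ht j).2.trans (signAngle_mem_Ioo (Nat.succ_le_of_lt j.2)).2⟩
  have htinj : Function.Injective t := by
    intro i j hij
    have h1 := signAngle_lt_of_lt ((ht i).1.trans_le (hij.le.trans (ht j).2.le))
    have h2 := signAngle_lt_of_lt ((ht j).1.trans_le (hij.ge.trans (ht i).2.le))
    exact Fin.ext (by omega)
  set w : Fin n → ℂ := fun j => (zeroParam α (2 * Real.cos (t j)) : ℂ)
  have hw : Function.Injective w := by
    intro i j hij
    have h1 := injOn_zeroParam hα (Set.Ioo_subset_Icc_self (two_mul_cos_mem_Ioo (htI i)))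
      (Set.Ioo_subset_Icc_self (two_mul_cos_mem_Ioo (htI j))) (Complex.ofReal_injective hij)
    exact htinj (Real.injOn_cos (Set.Ioo_subset_Icc_self (htI i))
      (Set.Ioo_subset_Icc_self (htI j)) (by linarith))
  classical
  set q : ℂ[X] := (fourTermPoly 1 1 α n).map (algebraMap ℝ ℂ)
  have hq : q ≠ 0 := (Polynomial.map_ne_zero_iff (algebraMap ℝ ℂ).injective).2
    (fourTermPoly_one_ne_zero α n)
  have hsub : Finset.univ.image w ⊆ q.roots.toFinset := by
    intro z hz
    obtain ⟨j, -, rfl⟩ := Finset.mem_image.1 hz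
    rw [Multiset.mem_toFinset, mem_roots hq, IsRoot.def, eval_map_algebraMap,
      aeval_ofReal_eq, hzero, Complex.ofReal_zero]
  have heq : Finset.univ.image w = q.roots.toFinset := by
    refine Finset.eq_of_subset_of_card_le hsub ?_
    rw [Finset.card_image_of_injective _ hw, Finset.card_univ, Fintype.card_fin]
    refine (Multiset.toFinset_card_le _).trans ((card_roots' q).trans ?_)
    rw [natDegree_map, natDegree_fourTermPoly_one]
  intro z hz
  have hz' : z ∈ q.roots.toFinset := by
    rw [Multiset.mem_toFinset, mem_roots hq, IsRoot.def, eval_map_algebraMap]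
    exact hz
  rw [← heq] at hz'
  obtain ⟨j, -, rfl⟩ := Finset.mem_image.1 hz'
  exact ⟨_, ⟨_, two_mul_cos_mem_Ioo (htI j), rfl⟩, rfl⟩

/-- Every interval of angles contains two consecutive sign angles once the degree is large. -/
lemma exists_zero_near {α : ℝ} (hα : α ≤ 1 / 9) {θ δ : ℝ} (hθ : 0 < θ) (hδ : 0 < δ)
    (hθδ : θ + δ ≤ Real.pi) (N : ℕ) :
    ∃ n, N ≤ n ∧ ∃ φ ∈ Set.Ioo θ (θ + δ),
      aeval (zeroParam α (2 * Real.cos φ)) (fourTermPoly 1 1 α n) = 0 := by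
  have hπ := Real.pi_pos
  obtain ⟨M, hM⟩ := exists_nat_gt (5 * Real.pi / (2 * δ))
  set n := max N M
  have hMn : (M : ℝ) ≤ n := by exact_mod_cast le_max_right N M
  rw [div_lt_iff₀ (by positivity)] at hM
  set j := ⌈θ * (n + 1) / Real.pi⌉₊
  have hj1 : θ * (n + 1) / Real.pi ≤ j := Nat.le_ceil _
  have hj2 : (j : ℝ) < θ * (n + 1) / Real.pi + 1 := Nat.ceil_lt_add_one (by positivity)
  rw [div_le_iff₀ hπ] at hj1
  rw [← sub_lt_iff_lt_add, lt_div_iff₀ hπ] at hj2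
  have hl : θ < signAngle n j := by
    rw [signAngle, lt_div_iff₀ (by positivity)]
    linarith
  have hr : signAngle n (j + 1) < θ + δ := by
    rw [signAngle, div_lt_iff₀ (by positivity)]
    push_cast
    nlinarith
  have hjn : j < n := by
    by_contra! h
    have h2 : signAngle n n ≤ signAngle n j := (signAngle_strictMono n).monotone h
    have h3 : signAngle n (n + 1) ≤ signAngle n (j + 1) :=
      (signAngle_strictMono n).monotone (by omega)
    have h4 : Real.pi < signAngle n (n + 1) := by
      rw [signAngle, lt_div_iff₀ (by positivity)]
      push_cast
      nlinarith
    linarith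
  obtain ⟨φ, hφ, h0⟩ := exists_zero_between hα hjn
  exact ⟨n, le_max_left N M, φ, ⟨hl.trans hφ.1, hφ.2.trans hr⟩, h0⟩

lemma Ioo_subset_closure_zeros {α : ℝ} (hα : α ≤ 1 / 9) (N : ℕ) :
    Set.Ioo (-zeroBound α) (zeroBound α) ⊆
      closure {x : ℝ | ∃ n : ℕ, N ≤ n ∧ (x : ℂ) ∈ complexZeros (fourTermPoly 1 1 α n)} := by
  intro x hx
  obtain ⟨u, hu, rfl⟩ := exists_zeroParam_eq hα hx
  set θ := Real.arccos (u / 2)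
  have hcos : 2 * Real.cos θ = u := by
    rw [Real.cos_arccos (by linarith [hu.1]) (by linarith [hu.2])]
    ring
  have hθ0 : 0 < θ := Real.arccos_pos.2 (by linarith [hu.2])
  have hθπ : θ < Real.pi := by
    refine lt_of_le_of_ne (Real.arccos_le_pi _) fun h => ?_
    rw [h, Real.cos_pi] at hcos
    linarith [hu.1]
  have hcont : ContinuousAt (fun φ => zeroParam α (2 * Real.cos φ)) θ := by
    have h2 : ContinuousAt (fun φ => 2 * Real.cos φ) θ := by fun_prop
    have h3 : ContinuousAt (zeroParam α) (2 * Real.cos θ) := by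
      rw [hcos]
      exact (continuousOn_zeroParam hα).continuousAt (Icc_mem_nhds hu.1 hu.2)
    exact ContinuousAt.comp (f := fun φ => 2 * Real.cos φ) h3 h2
  rw [Metric.mem_closure_iff]
  intro ε hε
  obtain ⟨δ, hδ, hclose⟩ := Metric.continuousAt_iff.1 hcont ε hε
  obtain ⟨n, hn, φ, hφ, h0⟩ := exists_zero_near hα hθ0
    (lt_min hδ (sub_pos.2 hθπ)) (by linarith [min_le_right δ (Real.pi - θ)]) N
  refine ⟨zeroParam α (2 * Real.cos φ), ⟨n, hn, ?_⟩, ?_⟩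
  · rw [mem_complexZeros, aeval_ofReal_eq, h0, Complex.ofReal_zero]
  · have := hclose (x := φ) (by
      rw [Real.dist_eq, abs_of_pos (by linarith [hφ.1])]
      linarith [hφ.2, min_le_left δ (Real.pi - θ)])
    rwa [hcos, dist_comm] at this

/-! ### Limits of averages of Cauchy kernels -/

/-- The averages of the kernels `1 / (z - r)` over multisets of points `r` of a compact set have a
limit along an ultrafilter which is holomorphic off that set: by the Banach-Alaoglu theorem the
averaging functionals on continuous functions converge, and the limit functional is applied to the
resolvent of the coordinate function. -/
lemma exists_differentiableOn_limit {K : Set ℂ} (hK : IsCompact K) (m : ℕ → Multiset ℂ)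
    (hm : ∀ n, ∀ r ∈ m n, r ∈ K) (hcard : ∀ n, (m n).card ≤ n) :
    ∃ G : ℂ → ℂ, DifferentiableOn ℂ G Kᶜ ∧ ∀ z ∈ Kᶜ,
      Tendsto (fun n : ℕ => (n : ℂ)⁻¹ * ((m n).map fun r => 1 / (z - r)).sum)
        (hyperfilter ℕ : Filter ℕ) (𝓝 (G z)) := by
  classical
  have : CompactSpace K := isCompact_iff_compactSpace.1 hK
  let a : C(K, ℂ) := ⟨Subtype.val, continuous_subtype_val⟩
  let e : ℂ → StrongDual ℂ C(K, ℂ) := fun r =>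
    if h : r ∈ K then ContinuousMap.evalCLM ℂ (⟨r, h⟩ : K) else 0
  have he : ∀ r, ‖e r‖ ≤ 1 := by
    intro r
    refine ContinuousLinearMap.opNorm_le_bound _ zero_le_one fun f => ?_
    by_cases h : r ∈ K
    · simpa [e, h] using f.norm_coe_le_norm ⟨r, h⟩
    · simp [e, h]
  let L : ℕ → StrongDual ℂ C(K, ℂ) := fun n => (n : ℂ)⁻¹ • ((m n).map e).sum
  have hL : ∀ n, ‖L n‖ ≤ 1 := by
    intro n
    have h1 : ‖((m n).map e).sum‖ ≤ n := by
      refine (norm_multiset_sum_le _).trans ?_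
      rw [Multiset.map_map]
      refine (Multiset.sum_le_card_nsmul _ 1 ?_).trans ?_
      · intro x hx
        obtain ⟨r, -, rfl⟩ := Multiset.mem_map.1 hx
        exact he r
      · rw [Multiset.card_map, nsmul_one]
        exact_mod_cast hcard n
    rw [norm_smul, norm_inv, Complex.norm_natCast]
    rcases Nat.eq_zero_or_pos n with rfl | hn
    · simp
    · rw [inv_mul_le_iff₀ (by exact_mod_cast hn), mul_one]
      exact h1
  obtain ⟨ℓ, -, hℓ⟩ := (WeakDual.isCompact_closedBall (0 : StrongDual ℂ C(K, ℂ)) 1)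
    |>.ultrafilter_le_nhds' ((hyperfilter ℕ).map fun n => StrongDual.toWeakDual (L n))
      (Ultrafilter.mem_map.2 (Filter.univ_mem' fun n => by simpa using hL n))
  have hres : ∀ z ∈ Kᶜ, z ∈ resolventSet ℂ a := by
    intro z hz
    rw [spectrum.mem_resolventSet_iff, ContinuousMap.isUnit_iff_forall_ne_zero]
    intro x h
    have h' : z - (x : ℂ) = 0 := h
    exact hz (by rw [sub_eq_zero.1 h']; exact x.2)
  have hval : ∀ z ∈ Kᶜ, ∀ x : K, resolvent a z x = 1 / (z - x) := by
    intro z hz x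
    have h1 := Ring.mul_inverse_cancel _ (hres z hz)
    have h2 : (z - (x : ℂ)) * resolvent a z x = 1 := congrArg (fun f : C(K, ℂ) => f x) h1
    exact eq_one_div_of_mul_eq_one_right h2
  refine ⟨fun z => ℓ (resolvent a z), fun z hz => ?_, fun z hz => ?_⟩
  · have h1 := spectrum.hasDerivAt_resolvent_const_left (hres z hz)
    exact ((WeakDual.toStrongDual ℓ).hasFDerivAt.comp_hasDerivAt z h1).differentiableAt
      |>.differentiableWithinAt
  · have h1 : Tendsto (fun n => StrongDual.toWeakDual (L n)) (hyperfilter ℕ : Filter ℕ) (𝓝 ℓ) := hℓ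
    have h2 := ((WeakDual.eval_continuous (resolvent a z)).tendsto ℓ).comp h1
    refine h2.congr fun n => ?_
    change (L n) (resolvent a z) = _
    have h3 : ∀ s : Multiset ℂ, (∀ r ∈ s, r ∈ K) →
        (s.map e).sum (resolvent a z) = (s.map fun r => 1 / (z - r)).sum := by
      intro s
      induction s using Multiset.induction_on with
      | empty => intro; simp
      | cons r s ih =>
        intro hs
        have hr : r ∈ K := hs r (Multiset.mem_cons_self r s)
        rw [Multiset.map_cons, Multiset.sum_cons, Multiset.map_cons, Multiset.sum_cons,
          add_apply, ih fun r' h => hs r' (Multiset.mem_cons_of_mem h)]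
        congr 1
        simp only [e, hr, dif_pos]
        exact hval z hz ⟨r, hr⟩
    simp only [L, smul_apply, smul_eq_mul, h3 (m n) (hm n)]

/-! ### The necessity of `b > 0` and `α ≤ 1/9` -/

lemma pos_of_isHyperbolic {a b c : ℝ} (ha : a ≠ 0) (hb : b ≠ 0)
    (h : IsHyperbolic (fourTermPoly a b c 2)) : 0 < b := by
  by_contra! hb'
  have hs := Real.sqrt_pos.2 (neg_pos.2 (lt_of_le_of_ne hb' hb))
  have hsq := Real.sq_sqrt (neg_nonneg.2 hb')
  have hsqC : (√(-b) : ℂ) ^ 2 = -b := by exact_mod_cast hsq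
  have ha' : (a : ℂ) ≠ 0 := by simpa using ha
  have him := h ((√(-b) / a : ℝ) * Complex.I) (by
    rw [mem_complexZeros, aeval_fourTermPoly_two, aeval_fourTermPoly_one]
    simp only [Complex.coe_algebraMap]
    push_cast
    field_simp
    linear_combination (√(-b) : ℂ) ^ 2 * Complex.I_sq - hsqC)
  rw [Complex.im_ofReal_mul, Complex.I_im, mul_one] at him
  exact div_ne_zero hs.ne' ha him

/-- The polynomial of degree 4 is `z⁴ - (3 - 2α) z² + 1 = (z² + 1)² - (5 - 2α) z²`, a product of two
quadratic polynomials with real coefficients when `5 - 2α ≥ 0`. -/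
lemma le_half_of_isHyperbolic {α : ℝ} (h : IsHyperbolic (fourTermPoly 1 1 α 4)) : α ≤ 1 / 2 := by
  have hmem : ∀ z : ℂ, z ^ 4 - (3 - 2 * α) * z ^ 2 + 1 = 0 → z.im = 0 := by
    intro z hz
    refine h z ?_
    rw [mem_complexZeros, aeval_fourTermPoly_add_three, aeval_fourTermPoly_add_three,
      zero_add, aeval_fourTermPoly_two, aeval_fourTermPoly_one, aeval_fourTermPoly_zero]
    simp only [Complex.coe_algebraMap, map_one]
    linear_combination hz
  by_contra! hα
  rcases le_total (5 - 2 * α) 0 with h0 | h0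
  · have h1 := Real.sq_sqrt (neg_nonneg.2 h0)
    -- the zero is `i y` with `y² - k y - 1 = 0`
    set k := √(-(5 - 2 * α))
    have hk : 0 ≤ k := Real.sqrt_nonneg _
    have h2 := Real.sq_sqrt (by positivity : 0 ≤ k ^ 2 + 4)
    have h3 : 0 < √(k ^ 2 + 4) := Real.sqrt_pos.2 (by positivity)
    set r := √(k ^ 2 + 4)
    have hy : ((k + r) / 2) ^ 4 + (3 - 2 * α) * ((k + r) / 2) ^ 2 + 1 = 0 := by
      have h4 : ((k + r) / 2) ^ 2 = k * ((k + r) / 2) + 1 := by linear_combination h2 / 4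
      have h5 : (((k + r) / 2) ^ 2 - 1) ^ 2 = k ^ 2 * ((k + r) / 2) ^ 2 := by
        linear_combination (((k + r) / 2) ^ 2 - 1 + k * ((k + r) / 2)) * h4
      linear_combination h5 + ((k + r) / 2) ^ 2 * h1
    have hyC : (((k + r) / 2 : ℝ) : ℂ) ^ 4 + (3 - 2 * α) * (((k + r) / 2 : ℝ) : ℂ) ^ 2 + 1 = 0 := by
      exact_mod_cast hy
    have := hmem (((k + r) / 2 : ℝ) * Complex.I) (by
      linear_combination hyC + ((((k + r) / 2 : ℝ) : ℂ) ^ 4 * (Complex.I ^ 2 - 1)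
        - (3 - 2 * α) * (((k + r) / 2 : ℝ) : ℂ) ^ 2) * Complex.I_sq)
    rw [Complex.im_ofReal_mul, Complex.I_im, mul_one] at this
    linarith
  · have h1 := Real.sq_sqrt h0
    set k := √(5 - 2 * α)
    have h2 : 0 < 4 - k ^ 2 := by linarith
    have h3 := Real.sq_sqrt h2.le
    have h4 := Real.sqrt_pos.2 h2
    set r := √(4 - k ^ 2)
    have h1C : (k : ℂ) ^ 2 = 5 - 2 * α := by exact_mod_cast h1
    have h3C : (r : ℂ) ^ 2 = 4 - (k : ℂ) ^ 2 := by exact_mod_cast h3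
    set z : ℂ := (k + r * Complex.I) / 2 with hzdef
    have hz : z ^ 2 - k * z + 1 = 0 := by
      rw [hzdef]
      linear_combination (r : ℂ) ^ 2 / 4 * Complex.I_sq - h3C / 4
    have := hmem z (by
      linear_combination (z ^ 2 + k * z + 1) * hz + z ^ 2 * h1C)
    have him : z.im = r / 2 := by
      rw [hzdef]; simp
    rw [him] at this
    linarith

/-- All zeros lie in the disc of radius 4. -/
lemma aeval_fourTermPoly_ne_zero {α : ℝ} (h0 : 0 ≤ α) (h1 : α ≤ 1 / 2) {z : ℂ} (hz : 4 ≤ ‖z‖)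
    (n : ℕ) : aeval z (fourTermPoly 1 1 α n) ≠ 0 := by
  have key : ∀ n, 2 * ‖aeval z (fourTermPoly 1 1 α n)‖ ≤
      ‖aeval z (fourTermPoly 1 1 α (n + 1))‖ := by
    intro n
    induction n using Nat.strong_induction_on with
    | _ n ih =>
      match n, ih with
      | 0, _ =>
        rw [aeval_fourTermPoly_zero, aeval_fourTermPoly_one]
        simp only [map_one, one_mul, norm_neg, norm_one]
        linarith
      | 1, _ =>
        rw [aeval_fourTermPoly_two, aeval_fourTermPoly_one]
        simp only [map_one, one_mul, norm_neg]
        have := norm_sub_norm_le (z * z) 1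
        rw [norm_mul, norm_one] at this
        rw [mul_neg, neg_neg]
        nlinarith
      | n + 2, ih =>
        have i0 := ih n (by omega)
        have i1 := ih (n + 1) (by omega)
        simp only [add_assoc, Nat.reduceAdd] at i0 i1 ⊢
        rw [aeval_fourTermPoly_add_three]
        simp only [map_one, one_mul, Complex.coe_algebraMap]
        generalize aeval z (fourTermPoly 1 1 α n) = p0 at *
        generalize aeval z (fourTermPoly 1 1 α (n + 1)) = p1 at *
        generalize aeval z (fourTermPoly 1 1 α (n + 2)) = p2 at *
        have e1 := norm_sub_norm_le (-(z * p2) - p1) (α * z * p0)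
        have e2 := norm_sub_norm_le (-(z * p2)) p1
        rw [norm_neg, norm_mul] at e2
        have e3 : ‖(α : ℂ) * z * p0‖ = α * ‖z‖ * ‖p0‖ := by
          rw [norm_mul, norm_mul, Complex.norm_real, Real.norm_of_nonneg h0]
        have e4 : α * ‖z‖ * ‖p0‖ ≤ 1 / 2 * ‖z‖ * (‖p2‖ / 4) := by
          gcongr
          linarith
        have e5 : 4 * ‖p2‖ ≤ ‖z‖ * ‖p2‖ := by gcongr
        linarith [norm_nonneg p2]
  have hpos : ∀ n, 0 < ‖aeval z (fourTermPoly 1 1 α n)‖ := by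
    intro n
    induction n with
    | zero => simp [aeval_fourTermPoly_zero]
    | succ n ih => linarith [key n]
  exact norm_pos_iff.1 (hpos n)

/-- The parameter `z` for which `x` is a root of `x³ + z x² + x + α z`. -/
noncomputable def paramOfRoot (α : ℝ) (x : ℂ) : ℂ := -(x ^ 3 + x) / (x ^ 2 + α)

/-- The derivative of `paramOfRoot`. -/
noncomputable def paramOfRootDeriv (α : ℝ) (x : ℂ) : ℂ :=
  -(x ^ 4 + (3 * α - 1) * x ^ 2 + α) / (x ^ 2 + α) ^ 2

lemma hasDerivAt_paramOfRoot {α : ℝ} {x : ℂ} (hx : x ^ 2 + α ≠ 0) :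
    HasDerivAt (paramOfRoot α) (paramOfRootDeriv α x) x := by
  have h1 : HasDerivAt (fun x : ℂ => -(x ^ 3 + x)) (-(3 * x ^ 2 + 1)) x := by
    simpa using ((hasDerivAt_pow 3 x).fun_add (hasDerivAt_id' x)).fun_neg
  have h2 : HasDerivAt (fun x : ℂ => x ^ 2 + (α : ℂ)) (2 * x) x := by
    simpa using (hasDerivAt_pow 2 x).add_const (α : ℂ)
  convert! h1.div h2 hx using 1
  rw [paramOfRootDeriv]
  congr 1
  ring

lemma half_sq_le_norm {α : ℝ} (h0 : 0 ≤ α) (h1 : α ≤ 1 / 2) {x : ℂ} (hx : 8 ≤ ‖x‖) :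
    ‖x‖ ^ 2 / 2 ≤ ‖x ^ 2 + α‖ := by
  have := norm_sub_norm_le (x ^ 2) (-(α : ℂ))
  rw [sub_neg_eq_add, norm_neg, norm_pow, Complex.norm_real, Real.norm_of_nonneg h0] at this
  nlinarith

lemma sq_add_ne_zero {α : ℝ} (h0 : 0 ≤ α) (h1 : α ≤ 1 / 2) {x : ℂ} (hx : 8 ≤ ‖x‖) :
    x ^ 2 + (α : ℂ) ≠ 0 := by
  rw [← norm_pos_iff]
  have := half_sq_le_norm h0 h1 hx
  have : 0 < ‖x‖ := by linarith
  have : 0 < ‖x‖ ^ 2 / 2 := by positivity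
  linarith

/-- For large `x` the root `x` of the cubic dominates the other two. -/
lemma norm_aeval_div_pow_sub_one_le {α : ℝ} (h0 : 0 ≤ α) (h1 : α ≤ 1 / 2) {x : ℂ} (hx : 8 ≤ ‖x‖)
    (n : ℕ) : ‖aeval (paramOfRoot α x) (fourTermPoly 1 1 α n) / x ^ n - 1‖ ≤ 1 / 3 := by
  have hxpos : 0 < ‖x‖ := by linarith
  have hx0 : x ≠ 0 := norm_pos_iff.1 hxpos
  have hden := sq_add_ne_zero h0 h1 hx
  have hdn := half_sq_le_norm h0 h1 hx
  have hcubic : x ^ 3 + paramOfRoot α x * x ^ 2 + x + α * paramOfRoot α x = 0 := by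
    rw [paramOfRoot]; field_simp; ring
  have he1 : -paramOfRoot α x - x = (1 - α : ℝ) * x / (x ^ 2 + α) := by
    rw [paramOfRoot]; push_cast; field_simp; ring
  have hn1 : ‖-paramOfRoot α x - x‖ ≤ 2 / ‖x‖ := by
    rw [he1, norm_div, norm_mul, Complex.norm_real, Real.norm_of_nonneg (by linarith),
      div_le_div_iff₀ (norm_pos_iff.2 hden) hxpos]
    have : (1 - α) * ‖x‖ * ‖x‖ ≤ 1 * ‖x‖ * ‖x‖ := by gcongr; linarith
    nlinarith
  generalize paramOfRoot α x = z at *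
  -- `e₁` and `e₂` are the elementary symmetric functions of the two small roots
  set e₁ := -z - x
  set e₂ := 1 - x * e₁
  have hxe : ‖x * e₁‖ ≤ 2 := by
    rw [norm_mul]
    calc ‖x‖ * ‖e₁‖ ≤ ‖x‖ * (2 / ‖x‖) := by gcongr
      _ = 2 := by field_simp
  have hne1 : ‖e₁‖ ≤ 1 / 4 := by
    refine hn1.trans ?_
    rw [div_le_iff₀ hxpos]
    linarith
  have hne2 : ‖e₂‖ ≤ 3 := by
    refine (norm_sub_le _ _).trans ?_
    rw [norm_one]
    linarith
  set p : ℕ → ℂ := fun n => aeval z (fourTermPoly 1 1 α n)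
  have hd : ∀ n, ‖p (n + 1) - x * p n‖ ≤ 2 ^ (n + 1) := by
    intro n
    induction n using Nat.strong_induction_on with
    | _ n ih =>
      match n, ih with
      | 0, _ =>
        have : p (0 + 1) - x * p 0 = e₁ := by
          simp only [p, zero_add, aeval_fourTermPoly_one, aeval_fourTermPoly_zero, map_one, e₁]
          ring
        rw [this]
        norm_num
        linarith
      | 1, _ =>
        have : p (1 + 1) - x * p 1 = e₁ * e₁ - e₂ := by
          simp only [p, Nat.reduceAdd, aeval_fourTermPoly_two, aeval_fourTermPoly_one, map_one,
            e₁, e₂]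
          ring
        rw [this]
        have h2 : ‖e₁ * e₁‖ ≤ 1 / 4 * (1 / 4) := by rw [norm_mul]; gcongr
        have := norm_sub_le (e₁ * e₁) e₂
        norm_num
        linarith
      | n + 2, ih =>
        have i0 := ih n (by omega)
        have i1 := ih (n + 1) (by omega)
        have : p (n + 2 + 1) - x * p (n + 2) =
            e₁ * (p (n + 1 + 1) - x * p (n + 1)) - e₂ * (p (n + 1) - x * p n) := by
          simp only [p, add_assoc, Nat.reduceAdd, aeval_fourTermPoly_add_three, map_one,
            Complex.coe_algebraMap, e₁, e₂]
          linear_combination -(aeval z (fourTermPoly 1 1 α n)) * hcubic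
        rw [this]
        refine (norm_sub_le _ _).trans ?_
        rw [norm_mul, norm_mul]
        calc _ ≤ 1 / 4 * 2 ^ (n + 1 + 1) + 3 * 2 ^ (n + 1) := by gcongr
          _ ≤ (2 : ℝ) ^ (n + 2 + 1) := by
            rw [pow_succ _ (n + 1), pow_succ _ (n + 2), pow_succ _ (n + 1)]
            have : (0 : ℝ) < 2 ^ (n + 1) := by positivity
            linarith
  have hind : ∀ n, ‖p n / x ^ n - 1‖ ≤ (1 - (1 / 4) ^ n) / 3 := by
    intro n
    induction n with
    | zero => simp [p, aeval_fourTermPoly_zero]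
    | succ n ih =>
      have hsplit : p (n + 1) / x ^ (n + 1) - 1 =
          (p n / x ^ n - 1) + (p (n + 1) - x * p n) / x ^ (n + 1) := by
        field_simp
        ring
      have hstep : ‖(p (n + 1) - x * p n) / x ^ (n + 1)‖ ≤ (1 / 4) ^ (n + 1) := by
        rw [norm_div, norm_pow, div_le_iff₀ (by positivity), ← mul_pow]
        refine (hd n).trans ?_
        gcongr
        linarith
      rw [hsplit]
      refine (norm_add_le _ _).trans ((add_le_add ih hstep).trans (le_of_eq ?_))
      ring
  refine (hind n).trans ?_
  have : (0 : ℝ) ≤ (1 / 4) ^ n := by positivity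
  linarith

/-- The logarithmic derivative of `P_n(z(x)) / xⁿ` stays bounded for large `x`, so that of
`P_n(z(x))` is asymptotic to `n / x`. -/
lemma norm_logDeriv_sub_le {α : ℝ} (h0 : 0 ≤ α) (h1 : α ≤ 1 / 2) {x : ℂ} (hx : 9 < ‖x‖)
    (n : ℕ) : ‖aeval (paramOfRoot α x) (derivative (fourTermPoly 1 1 α n)) /
      aeval (paramOfRoot α x) (fourTermPoly 1 1 α n) * paramOfRootDeriv α x - n / x‖ ≤ 2 := by
  set P := fourTermPoly 1 1 α n
  set F : ℂ → ℂ := fun y => aeval (paramOfRoot α y) P / y ^ n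
  have hne : ∀ y : ℂ, 8 ≤ ‖y‖ → y ≠ 0 := fun y hy => norm_pos_iff.1 (by linarith)
  have hF : ∀ y : ℂ, 8 ≤ ‖y‖ → HasDerivAt F
      ((aeval (paramOfRoot α y) (derivative P) * paramOfRootDeriv α y * y ^ n -
        aeval (paramOfRoot α y) P * (n * y ^ (n - 1))) / (y ^ n) ^ 2) y := by
    intro y hy
    have e1 := (P.hasDerivAt_aeval (paramOfRoot α y)).comp y
      (hasDerivAt_paramOfRoot (sq_add_ne_zero h0 h1 hy))
    exact e1.div (hasDerivAt_pow n y) (pow_ne_zero n (hne y hy))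
  have hball : ∀ y ∈ Metric.closedBall x 1, 8 ≤ ‖y‖ := by
    intro y hy
    rw [Metric.mem_closedBall, dist_comm, dist_eq_norm] at hy
    have := norm_sub_norm_le x y
    linarith
  have hclose : ∀ y : ℂ, 8 ≤ ‖y‖ → ‖F y - 1‖ ≤ 1 / 3 := fun y hy =>
    norm_aeval_div_pow_sub_one_le h0 h1 hy n
  have hderiv : ‖deriv F x‖ ≤ 4 / 3 / 1 := by
    refine Complex.norm_deriv_le_of_forall_mem_sphere_norm_le one_pos ?_ fun y hy => ?_
    · refine DifferentiableOn.diffContOnCl fun y hy => ?_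
      rw [closure_ball _ one_ne_zero] at hy
      exact (hF y (hball y hy)).differentiableAt.differentiableWithinAt
    · have e1 := hclose y (hball y (Metric.sphere_subset_closedBall hy))
      have e2 := norm_add_le (F y - 1) 1
      rw [sub_add_cancel, norm_one] at e2
      linarith
  have hx8 : 8 ≤ ‖x‖ := by linarith
  have hx0 := hne x hx8
  have hlow : 2 / 3 ≤ ‖F x‖ := by
    have e1 := hclose x hx8
    have e2 := norm_sub_norm_le 1 (F x)
    rw [norm_one, norm_sub_rev] at e2
    linarith
  have hFx : F x ≠ 0 := norm_pos_iff.1 (by linarith)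
  have hP : aeval (paramOfRoot α x) P ≠ 0 := fun h => hFx (by simp [F, h])
  have hlog : aeval (paramOfRoot α x) (derivative P) / aeval (paramOfRoot α x) P *
      paramOfRootDeriv α x - n / x = deriv F x / F x := by
    rw [(hF x hx8).deriv]
    simp only [F]
    rcases n with _ | n
    · simp
      field_simp
    · rw [Nat.add_sub_cancel]
      field_simp
      ring
  rw [hlog, norm_div, div_le_iff₀ (by linarith)]
  linarith

/-- The critical points of `paramOfRoot` satisfy `x⁴ + (3α - 1) x² + α = 0`. For `1/9 < α < 1` they
are not real, and `paramOfRoot` takes no real values on the ray from such a point to infinity. -/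
lemma exists_critical_ray {α : ℝ} (h0 : 1 / 9 < α) (h1 : α < 1) :
    ∃ x : ℂ, x ≠ 0 ∧ paramOfRootDeriv α x = 0 ∧ ∀ t : ℝ, 0 < t →
      ((t * x : ℂ) ^ 2 + α ≠ 0 ∧ (paramOfRoot α (t * x)).im ≠ 0) := by
  have hδ : 0 < (9 * α - 1) * (1 - α) := mul_pos (by linarith) (by linarith)
  have hr := Real.sqrt_pos.2 hδ
  have hr2 := Real.sq_sqrt hδ.le
  set r := √((9 * α - 1) * (1 - α))
  obtain ⟨x, hx⟩ := IsAlgClosed.exists_pow_nat_eq (⟨(1 - 3 * α) / 2, r / 2⟩ : ℂ) two_pos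
  have hre : x.re ^ 2 - x.im ^ 2 = (1 - 3 * α) / 2 := by
    have := congrArg Complex.re hx
    simp only [pow_two, Complex.mul_re] at this
    linarith
  have him : 2 * x.re * x.im = r / 2 := by
    have := congrArg Complex.im hx
    simp only [pow_two, Complex.mul_im] at this
    linarith
  have hα : 0 < α := by linarith
  have hb2 := Real.sq_sqrt hα.le
  have hbpos := Real.sqrt_pos.2 hα
  have hm : x.re ^ 2 + x.im ^ 2 = √α := by
    refine (pow_left_inj₀ (by positivity) hbpos.le two_ne_zero).1 ?_
    linear_combination (x.re ^ 2 - x.im ^ 2 + (1 - 3 * α) / 2) * hre +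
      (2 * x.re * x.im + r / 2) * him + hr2 / 4 - hb2
  have hq : x.im ≠ 0 := fun h => by rw [h] at him; linarith
  have hp : x.re ≠ 0 := fun h => by rw [h] at him; linarith
  refine ⟨x, fun h => hq (by rw [h, Complex.zero_im]), ?_, fun t ht => ?_⟩
  · have hcrit : x ^ 4 + (3 * α - 1) * x ^ 2 + α = 0 := by
      have hX : (⟨(1 - 3 * α) / 2, r / 2⟩ : ℂ) ^ 2 +
          ((3 * α - 1 : ℝ) : ℂ) * ⟨(1 - 3 * α) / 2, r / 2⟩ + (α : ℂ) = 0 := by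
        apply Complex.ext
        · simp only [pow_two, Complex.add_re, Complex.mul_re, Complex.ofReal_re,
            Complex.ofReal_im, Complex.zero_re]
          linear_combination -hr2 / 4
        · simp only [pow_two, Complex.add_im, Complex.mul_im, Complex.ofReal_re,
            Complex.ofReal_im, Complex.zero_im]
          ring
      rw [← hx] at hX
      push_cast at hX
      linear_combination hX
    rw [paramOfRootDeriv, hcrit, neg_zero, zero_div]
  · have hden : (t * x : ℂ) ^ 2 + α ≠ 0 := by
      intro h
      have := congrArg Complex.im h
      simp only [pow_two, Complex.add_im, Complex.mul_im, Complex.mul_re, Complex.ofReal_re,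
        Complex.ofReal_im, Complex.zero_im] at this
      have h' : t ^ 2 * (2 * x.re * x.im) = 0 := by linear_combination this
      rw [him] at h'
      have : 0 < t ^ 2 * (r / 2) := by positivity
      linarith
    refine ⟨hden, fun h => ?_⟩
    -- the imaginary part is `-Im(t x) N / |(t x)² + α|²`, where `N > 0`
    have hw : paramOfRoot α (t * x) * ((t * x : ℂ) ^ 2 + α) = -((t * x : ℂ) ^ 3 + t * x) := by
      rw [paramOfRoot, div_mul_cancel₀ _ hden]
    have hwre := congrArg Complex.re hw
    have hwim := congrArg Complex.im hw
    generalize paramOfRoot α (t * x) = w at *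
    simp only [pow_succ, pow_zero, one_mul, Complex.add_re, Complex.add_im, Complex.neg_re,
      Complex.neg_im, Complex.mul_re, Complex.mul_im, Complex.ofReal_re, Complex.ofReal_im, h]
      at hwre hwim
    generalize x.re = p at *
    generalize x.im = q at *
    generalize w.re = v at *
    have hN : t * q * (t ^ 4 * (p ^ 2 + q ^ 2) ^ 2 + t ^ 2 * ((p ^ 2 + q ^ 2) * (α - 1)
        + 2 * α * (p ^ 2 - q ^ 2)) + α) = 0 := by
      linear_combination (t ^ 2 * (p ^ 2 - q ^ 2) + α) * hwim - 2 * t ^ 2 * p * q * hwre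
    have hN' := (mul_eq_zero.1 hN).resolve_left (mul_ne_zero ht.ne' hq)
    rw [hm, hre] at hN'
    have hβ3 : 1 / 3 < √α := Real.lt_sqrt_of_sq_lt (by linarith)
    have hβ1 : √α < 1 := by
      rw [Real.sqrt_lt' one_pos]; linarith
    generalize √α = β at *
    have hpos : 0 < t ^ 2 * (β * ((3 * β - 1) * (1 - β ^ 2))) := by
      have : 0 < 1 - β ^ 2 := by nlinarith
      have : 0 < 3 * β - 1 := by linarith
      positivity
    have hsq : 0 ≤ α * (t ^ 2 - 1) ^ 2 := by positivity
    rw [← hb2] at hN' hsq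
    nlinarith

/-- If all polynomials were hyperbolic for some `1/9 < α ≤ 1/2`, a limit `G` of the functions
`P_n' / (n P_n)` would be holomorphic off the real line. In the variable `x`, a root of the cubic
`x³ + z x² + x + α z`, one has `G(z(x)) z'(x) = 1 / x` for large `x`, hence along the ray which ends
at a critical point of `z(x)`; but there the left side vanishes. -/
lemma le_one_ninth_of_isHyperbolic {α : ℝ} (h1 : α ≤ 1 / 2)
    (h : ∀ n, IsHyperbolic (fourTermPoly 1 1 α n)) : α ≤ 1 / 9 := by
  by_contra! hα
  have h0 : 0 ≤ α := by linarith
  set P := fourTermPoly 1 1 α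
  have hP0 : ∀ n, (P n).map (algebraMap ℝ ℂ) ≠ 0 := fun n =>
    (Polynomial.map_ne_zero_iff (algebraMap ℝ ℂ).injective).2 (fourTermPoly_one_ne_zero α n)
  set K : Set ℂ := Complex.ofReal '' Set.Icc (-4) 4
  have hK : IsCompact K := isCompact_Icc.image Complex.continuous_ofReal
  have hKim : ∀ z : ℂ, z.im ≠ 0 → z ∈ Kᶜ := by
    rintro _ hz ⟨y, -, rfl⟩
    exact hz (Complex.ofReal_im y)
  have hzeros : ∀ n, ∀ z : ℂ, aeval z (P n) = 0 → z ∈ K := by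
    intro n z hz
    have hz4 : ‖z‖ < 4 := by
      by_contra! h4
      exact aeval_fourTermPoly_ne_zero h0 h1 h4 n hz
    refine ⟨z.re, abs_le.1 ((Complex.abs_re_le_norm z).trans hz4.le), ?_⟩
    exact Complex.ext (Complex.ofReal_re _) (by rw [Complex.ofReal_im, h n z hz])
  obtain ⟨G, hG, hlim⟩ := exists_differentiableOn_limit hK
    (fun n => ((P n).map (algebraMap ℝ ℂ)).roots)
    (fun n r hr => hzeros n r (by
      have := (mem_roots (hP0 n)).1 hr
      rwa [IsRoot.def, eval_map_algebraMap] at this))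
    (fun n => (card_roots' _).trans (by rw [natDegree_map, natDegree_fourTermPoly_one]))
  have hlim' : ∀ z ∈ Kᶜ, Tendsto
      (fun n : ℕ => (n : ℂ)⁻¹ * (aeval z (derivative (P n)) / aeval z (P n)))
      (hyperfilter ℕ : Filter ℕ) (𝓝 (G z)) := by
    intro z hz
    refine (hlim z hz).congr fun n => ?_
    have hne : ((P n).map (algebraMap ℝ ℂ)).eval z ≠ 0 := by
      rw [eval_map_algebraMap]
      exact fun h' => hz (hzeros n z h')
    rw [← (IsAlgClosed.splits _).eval_derivative_div_eval_of_ne_zero hne, derivative_map,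
      eval_map_algebraMap, eval_map_algebraMap]
  obtain ⟨x, hx0, hcrit, hray⟩ := exists_critical_ray hα (by linarith)
  -- the domain of `x` on which the identity is continued
  set V : Set ℂ := {y | y ^ 2 + (α : ℂ) ≠ 0}
  have hV : IsOpen V := isOpen_ne_fun (by fun_prop) (by fun_prop)
  have hZ : ContinuousOn (paramOfRoot α) V := fun y hy =>
    (hasDerivAt_paramOfRoot hy).continuousAt.continuousWithinAt
  set U : Set ℂ := (V ∩ paramOfRoot α ⁻¹' {z | z.im ≠ 0}) ∩ {y | y ≠ 0}
  have hU : IsOpen U :=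
    (hZ.isOpen_inter_preimage hV (isOpen_ne_fun Complex.continuous_im continuous_const)).inter
      isOpen_ne
  have hf : DifferentiableOn ℂ (fun y => G (paramOfRoot α y) * paramOfRootDeriv α y) U := by
    rintro y ⟨⟨hy1, hy2⟩, -⟩
    have hy1' : y ^ 2 + (α : ℂ) ≠ 0 := hy1
    have e1 : DifferentiableAt ℂ G (paramOfRoot α y) :=
      (hG _ (hKim _ hy2)).differentiableAt (hK.isClosed.isOpen_compl.mem_nhds (hKim _ hy2))
    have e2 := e1.comp y (hasDerivAt_paramOfRoot hy1').differentiableAt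
    have e3 : DifferentiableAt ℂ (paramOfRootDeriv α) y := by
      unfold paramOfRootDeriv
      exact DifferentiableAt.div (by fun_prop) (by fun_prop) (pow_ne_zero 2 hy1')
    exact (e2.mul e3).differentiableWithinAt
  have hg : DifferentiableOn ℂ (fun y : ℂ => 1 / y) U := fun y hy =>
    ((differentiableAt_const (1 : ℂ)).fun_div differentiableAt_fun_id
      (show y ≠ 0 from hy.2)).differentiableWithinAt
  have hfar : ∀ y ∈ U, 9 < ‖y‖ → G (paramOfRoot α y) * paramOfRootDeriv α y = 1 / y := by
    rintro y ⟨⟨-, hy2⟩, hy3⟩ hy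
    have e1 := (hlim' _ (hKim _ hy2)).mul_const (paramOfRootDeriv α y)
    refine tendsto_nhds_unique e1 ?_
    refine Tendsto.mono_left ?_ Nat.hyperfilter_le_atTop
    rw [tendsto_iff_norm_sub_tendsto_zero]
    refine squeeze_zero' (Eventually.of_forall fun n => norm_nonneg _) ?_
      (tendsto_const_div_atTop_nhds_zero_nat (2 : ℝ))
    filter_upwards [eventually_gt_atTop 0] with n hn
    have hn' : (n : ℂ) ≠ 0 := by exact_mod_cast hn.ne'
    have e2 : (n : ℂ)⁻¹ * (aeval (paramOfRoot α y) (derivative (P n)) /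
          aeval (paramOfRoot α y) (P n)) * paramOfRootDeriv α y - 1 / y =
        (n : ℂ)⁻¹ * (aeval (paramOfRoot α y) (derivative (P n)) /
          aeval (paramOfRoot α y) (P n) * paramOfRootDeriv α y - n / y) := by
      have : y ≠ 0 := hy3
      rw [mul_sub, mul_assoc]
      congr 1
      field_simp
    rw [e2, norm_mul, norm_inv, Complex.norm_natCast, div_eq_inv_mul (2 : ℝ)]
    exact mul_le_mul_of_nonneg_left (norm_logDeriv_sub_le h0 h1 hy n) (by positivity)
  set S : Set ℂ := (fun t : ℝ => (t * x : ℂ)) '' Set.Ici 1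
  have hS : IsPreconnected S := isPreconnected_Ici.image _ (by fun_prop)
  have hSU : S ⊆ U := by
    rintro _ ⟨t, ht, rfl⟩
    have ht0 : 0 < t := lt_of_lt_of_le one_pos ht
    exact ⟨hray t ht0, mul_ne_zero (by exact_mod_cast ht0.ne') hx0⟩
  have hxn : 0 < ‖x‖ := norm_pos_iff.2 hx0
  set t₀ := max 1 (10 / ‖x‖)
  have ht₀ : (t₀ * x : ℂ) ∈ S := ⟨t₀, Set.mem_Ici.2 (le_max_left _ _), rfl⟩
  have hbig : 9 < ‖(t₀ * x : ℂ)‖ := by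
    rw [norm_mul, Complex.norm_real, Real.norm_of_nonneg (zero_le_one.trans (le_max_left _ _))]
    have : 10 / ‖x‖ * ‖x‖ ≤ t₀ * ‖x‖ := by gcongr; exact le_max_right _ _
    rw [div_mul_cancel₀ _ hxn.ne'] at this
    linarith
  have hev : (fun y => G (paramOfRoot α y) * paramOfRootDeriv α y) =ᶠ[𝓝 (t₀ * x : ℂ)]
      fun y => 1 / y := by
    filter_upwards [hU.mem_nhds (hSU ht₀), continuous_norm.continuousAt.eventually
      (lt_mem_nhds hbig)] with y hy hy9 using hfar y hy hy9
  have heq := ((hf.analyticOnNhd hU).mono hSU).eqOn_of_preconnected_of_eventuallyEq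
    ((hg.analyticOnNhd hU).mono hSU) hS ht₀ hev
  have hxS : x ∈ S := ⟨1, Set.self_mem_Ici, by simp⟩
  have := heq hxS
  simp only [hcrit, mul_zero] at this
  exact one_div_ne_zero hx0 this.symm

/-! ### The general recurrence -/

lemma isHyperbolic_scale_iff {a b : ℝ} (c : ℝ) (ha : a ≠ 0) (hb : 0 < b) (n : ℕ) :
    IsHyperbolic (fourTermPoly a b c n) ↔ IsHyperbolic (fourTermPoly 1 1 (c / (a * b)) n) := by
  have hk : a / √b ≠ 0 := div_ne_zero ha (Real.sqrt_pos.2 hb).ne'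
  have hk' : ((a / √b : ℝ) : ℂ) ≠ 0 := by exact_mod_cast hk
  constructor
  · intro h w hw
    have hw' : (a / √b : ℝ) * (((a / √b : ℝ) : ℂ)⁻¹ * w) = w := mul_inv_cancel_left₀ hk' w
    have := h (((a / √b : ℝ) : ℂ)⁻¹ * w) ((mem_complexZeros_scale c ha hb _ n).2 (by rwa [hw']))
    rw [← hw', Complex.im_ofReal_mul, this, mul_zero]
  · intro h z hz
    have := h _ ((mem_complexZeros_scale c ha hb z n).1 hz)
    rw [Complex.im_ofReal_mul] at this
    exact (mul_eq_zero.1 this).resolve_left hk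

lemma mul_mem_Ioo_zeroBound_iff {a b : ℝ} (c : ℝ) (ha : a ≠ 0) (hb : 0 < b) (x : ℝ) :
    a / √b * x ∈ Set.Ioo (-zeroBound (c / (a * b))) (zeroBound (c / (a * b))) ↔
      x ∈ Set.Ioo (-zeroRadius a b c) (zeroRadius a b c) := by
  have hs := Real.sqrt_pos.2 hb
  have ha' := abs_pos.2 ha
  rw [Set.mem_Ioo, Set.mem_Ioo, ← abs_lt, ← abs_lt, zeroRadius, abs_mul, abs_div,
    abs_of_pos hs, div_mul_eq_mul_div, div_mul_eq_mul_div, div_lt_iff₀ hs, lt_div_iff₀ ha',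
    mul_comm |x|, mul_comm (√b)]

theorem theorem1 (a b c : ℝ) (ha : a ≠ 0) (hb : b ≠ 0) (hc : c ≠ 0) :
    ((∀ n : ℕ, IsHyperbolic (fourTermPoly a b c n)) ↔ (0 < b ∧ c / (a * b) ≤ 1 / 9)) ∧
    ((0 < b ∧ c / (a * b) ≤ 1 / 9) →
      (∀ n : ℕ, complexZeros (fourTermPoly a b c n) ⊆
        Complex.ofReal '' Set.Ioo (-zeroRadius a b c) (zeroRadius a b c)) ∧
      (∀ N : ℕ, Set.Ioo (-zeroRadius a b c) (zeroRadius a b c) ⊆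
        closure {x : ℝ | ∃ n : ℕ, N ≤ n ∧ (x : ℂ) ∈ complexZeros (fourTermPoly a b c n)})) := by
  have hloc : 0 < b ∧ c / (a * b) ≤ 1 / 9 → ∀ n : ℕ, complexZeros (fourTermPoly a b c n) ⊆
      Complex.ofReal '' Set.Ioo (-zeroRadius a b c) (zeroRadius a b c) := by
    rintro ⟨hb0, hα⟩ n z hz
    have hk : a / √b ≠ 0 := div_ne_zero ha (Real.sqrt_pos.2 hb0).ne'
    have hk' : ((a / √b : ℝ) : ℂ) ≠ 0 := by exact_mod_cast hk
    obtain ⟨w, ⟨u, hu, rfl⟩, hw⟩ := complexZeros_subset_zeroParam hα n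
      ((mem_complexZeros_scale c ha hb0 z n).1 hz)
    refine ⟨(a / √b)⁻¹ * zeroParam (c / (a * b)) u, ?_, ?_⟩
    · rw [← mul_mem_Ioo_zeroBound_iff c ha hb0, mul_inv_cancel_left₀ hk]
      exact zeroParam_mem_Ioo hα hu
    · rw [Complex.ofReal_mul, Complex.ofReal_inv, hw, inv_mul_cancel_left₀ hk']
  refine ⟨⟨fun h => ?_, fun h n z hz => ?_⟩, fun h => ⟨hloc h, fun N x hx => ?_⟩⟩
  · have hb0 := pos_of_isHyperbolic ha hb (h 2)
    have h' := fun n => (isHyperbolic_scale_iff c ha hb0 n).1 (h n)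
    exact ⟨hb0, le_one_ninth_of_isHyperbolic (le_half_of_isHyperbolic (h' 4)) h'⟩
  · obtain ⟨x, -, rfl⟩ := hloc h n hz
    exact Complex.ofReal_im x
  · obtain ⟨hb0, hα⟩ := h
    have hk : a / √b ≠ 0 := div_ne_zero ha (Real.sqrt_pos.2 hb0).ne'
    have h1 := Ioo_subset_closure_zeros hα N ((mul_mem_Ioo_zeroBound_iff c ha hb0 x).2 hx)
    have h2 := image_closure_subset_closure_image
      (continuous_const_mul (a / √b)⁻¹) (Set.mem_image_of_mem _ h1)
    rw [inv_mul_cancel_left₀ hk] at h2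
    refine closure_mono ?_ h2
    rintro _ ⟨y, ⟨n, hn, hy⟩, rfl⟩
    refine ⟨n, hn, (mem_complexZeros_scale c ha hb0 _ n).2 ?_⟩
    rwa [← Complex.ofReal_mul, mul_inv_cancel_left₀ hk]
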